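/- Let $n\ge 1$ and $p\ge 1$ be integers. Realize the complex projective space $X=\mathbb{CP}^{n-1}$ as the set of rank-one orthogonal projections $\Pi_z$ of $\mathbb{C}^n$, where $z\in\mathbb{C}^n$, $|z|=1$, and $\Pi_z$ corresponds to the line $[z]=\mathbb{C}z$. Let $L$ be the dual of the tautological line bundle over $X$, with its Fubini–Study connection (the dual of the connection on the tautological bundle obtained by orthogonally projecting the trivial connection of $X\times\mathbb{C}^n$), and let $\nabla^{L^p}$ be the induced connection on $L^p=L^{\otimes p}$. Let $T_0\subset U(n)$ be the torus of diagonal matrices whose first diagonal entry is $1$; its moment map is $$\mu_0:X\to\mathbb{R}^{n-1},\qquad \mu_0(\Pi_z)=(|z_2|^2,\dots,|z_n|^2),$$ with image the simplex $$\Delta=\Big\{(\nu_2,\dots,\nu_n)\in\mathbb{R}^{n-1}\ \Big|\ \sum_{j=2}^n\nu_j\le 1,\ \nu_k\ge 0\text{ for all }2\le k\le n\Big\}.$$ A properly embedded orientable smooth submanifold $\iota:\Lambda\hookrightarrow X$ is said to satisfy the Bohr–Sommerfeld condition at level $p$ if there is a nowhere vanishing smooth section $\zeta$ of $\iota^*L^p$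 over $\Lambda$ with $\nabla^{\iota^*L^p}\zeta=0$. Let $\nu\in\Delta$. Then the fibre $\Lambda_\nu:=\mu_0^{-1}(\nu)\subset X$ is a properly embedded orientable smooth submanifold, and it satisfies the Bohr–Sommerfeld condition at level $p$ if and only if $$\nu\in\Delta\cap\Big(\tfrac1p\,\mathbb{Z}^{n-1}\Big).$$ -/

import Mathlib

open scoped ContDiff

noncomputable section

namespace BohrSommerfeld

/-! ### Embedded submanifolds of a normed space -/

section Submanifold

variable {E : Type*} [NormedAddCommGroup E] [NormedSpace ℝ E]

/-- A smooth regular `k`-dimensional local parametrization of a subset `Λ` of a normed space: a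
smooth immersion of an open subset of `ℝᵏ` which is a homeomorphism onto a relatively open
subset of `Λ`. -/
structure LocalParametrization (Λ : Set E) (k : ℕ) where
  toFun : EuclideanSpace ℝ (Fin k) → E
  source : Set (EuclideanSpace ℝ (Fin k))
  isOpen_source : IsOpen source
  contDiffOn : ContDiffOn ℝ ∞ toFun source
  injective_fderiv : ∀ a ∈ source, Function.Injective (fderiv ℝ toFun a)
  isEmbedding : Topology.IsEmbedding (source.domRestrict toFun)
  image_eq : ∃ U : Set E, IsOpen U ∧ toFun '' source = U ∩ Λ

/-- `Λ` is a `k`-dimensional smooth embedded submanifold which can be oriented: it is covered by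
local parametrizations whose coordinate changes all have positive Jacobian determinant.
(Where `φ a = ψ b`, the derivative `J` at `a` of the coordinate change `ψ⁻¹ ∘ φ` is determined by
`D φ a = D ψ b ∘ J`.) -/
def IsOrientableSubmanifold (Λ : Set E) (k : ℕ) : Prop :=
  ∃ 𝒜 : Set (LocalParametrization Λ k),
    (∀ x ∈ Λ, ∃ φ ∈ 𝒜, ∃ a ∈ φ.source, φ.toFun a = x) ∧
    ∀ φ ∈ 𝒜, ∀ ψ ∈ 𝒜, ∀ a ∈ φ.source, ∀ b ∈ ψ.source, φ.toFun a = ψ.toFun b →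
      ∃ J : EuclideanSpace ℝ (Fin k) →L[ℝ] EuclideanSpace ℝ (Fin k),
        fderiv ℝ φ.toFun a = (fderiv ℝ ψ.toFun b).comp J ∧ 0 < J.det

/-- The tangent vectors to `Λ` at `x`: velocities at `x` of smooth curves contained in `Λ`. -/
def tangentVectors (Λ : Set E) (x : E) : Set E :=
  {v | ∃ γ : ℝ → E, ContDiff ℝ ∞ γ ∧ (∀ t, γ t ∈ Λ) ∧ γ 0 = x ∧ HasDerivAt γ v 0}

/-- A map on a submanifold `Λ` of `E` is smooth if it is, near each point of `Λ`, the restriction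
of a smooth map defined on an open subset of `E`. Only the values of `f` on `Λ` matter. -/
def IsSmoothAlong {F : Type*} [NormedAddCommGroup F] [NormedSpace ℝ F]
    (f : E → F) (Λ : Set E) : Prop :=
  ∀ x ∈ Λ, ∃ U : Set E, IsOpen U ∧ x ∈ U ∧
    ∃ g : E → F, ContDiffOn ℝ ∞ g U ∧ Set.EqOn f g (U ∩ Λ)

end Submanifold

/-! ### Complex projective space and its prequantizing line bundle -/

/-- The Hermitian space `ℂⁿ` with `n = m + 1`, coordinates indexed by `0, …, m`. -/
abbrev V (m : ℕ) : Type := EuclideanSpace ℂ (Fin (m + 1))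

/-- The orthogonal projection `Π_z : w ↦ ⟨z, w⟩ z` (conjugate linear in `z`, linear in `w`) onto the line spanned by the unit vector `z`. -/
def proj {m : ℕ} (z : V m) : V m →L[ℂ] V m := InnerProductSpace.rankOne ℂ z z

/-- Complex projective space `ℂP^m`, realized as the (co)adjoint orbit of orthogonal projections
of rank one inside the Hermitian operators on `ℂ^{m+1}`; `Π_z` corresponds to the line `[z]`. -/
def projectiveSpace (m : ℕ) : Set (V m →L[ℂ] V m) :=
  {A | ∃ z : V m, ‖z‖ = 1 ∧ A = proj z}

/-- The torus moment map `Π_z ↦ (|z_2|², …, |z_n|²)`, i.e. the diagonal entries of `Π_z` except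
the first one (see `momentMap_proj`). -/
def momentMap {m : ℕ} (A : V m →L[ℂ] V m) : Fin m → ℝ :=
  fun j => (A (EuclideanSpace.single j.succ 1) j.succ).re

theorem momentMap_proj {m : ℕ} (z : V m) (j : Fin m) :
    momentMap (proj z) j = ‖z j.succ‖ ^ 2 := by
  simp [momentMap, proj, InnerProductSpace.rankOne_apply, EuclideanSpace.inner_single_right,
    ← Complex.normSq_eq_norm_sq, Complex.normSq_apply]

/-- The fibre `Λ_ν ⊆ ℂP^m` of the moment map over `ν`. -/
def momentFibre {m : ℕ} (ν : Fin m → ℝ) : Set (V m →L[ℂ] V m) :=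
  {A | A ∈ projectiveSpace m ∧ momentMap A = ν}

/-- The simplex `Δ` of all `ν` with nonnegative entries of sum at most `1`. -/
def simplex (m : ℕ) : Set (Fin m → ℝ) :=
  {ν | ∑ j, ν j ≤ 1 ∧ ∀ j, 0 ≤ ν j}

/-- The lattice `(1/p) ℤ^m`. -/
def scaledLattice (m p : ℕ) : Set (Fin m → ℝ) :=
  {ν | ∃ k : Fin m → ℤ, ∀ j, ν j = (1 / (p : ℝ)) * (k j : ℝ)}

/-- Continuous `p`-linear forms on `ℂ^{m+1}`, i.e. the `p`-th tensor power of the dual space. -/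
abbrev Forms (m p : ℕ) : Type := ContinuousMultilinearMap ℂ (fun _ : Fin p => V m) ℂ

/-- Restriction of a `p`-linear form to the line `im A`, extended back to `ℂ^{m+1}` by the
projection `A`. For `A = Π_z` this is the orthogonal projection of `Forms m p` onto the fibre of
`L^p` at `A`. -/
def compress {m p : ℕ} (A : V m →L[ℂ] V m) (α : Forms m p) : Forms m p :=
  α.compContinuousLinearMap (fun _ => A)

/-- The fibre at `A ∈ ℂP^m` of `L^p`, where `L` is the dual of the tautological line bundle: the
fibre of `L` at `A` is the dual of the line `im A`, so that `L^p` has as fibre the `p`-linear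
forms on `im A`. These are identified with the `p`-linear forms on `ℂ^{m+1}` which factor through
the orthogonal projection `A`; this makes `L^p` a smooth subbundle of the trivial bundle
with fibre `Forms m p`. -/
def lineBundleFibre {m : ℕ} (p : ℕ) (A : V m →L[ℂ] V m) : Set (Forms m p) :=
  {α | ∀ w : Fin p → V m, α (fun i => A (w i)) = α w}

/-- The covariant derivative `∇_v ζ` at `x ∈ Λ`, along a vector `v` tangent to `Λ`, of a section
`ζ` of `L^p` over `Λ`. The Fubini–Study (Chern) connection of the tautological bundle
`im A ⊆ ℂ^{m+1}` is the orthogonal projection of the trivial connection `d`; consequently the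
induced connection on its dual `L`, and the one on `L^p` given by the Leibniz rule, are
`∇ ζ = (d ζ) restricted to im A`. -/
def covariantDerivative {m p : ℕ} (Λ : Set (V m →L[ℂ] V m))
    (ζ : (V m →L[ℂ] V m) → Forms m p) (x v : V m →L[ℂ] V m) : Forms m p :=
  compress x (fderivWithin ℝ ζ Λ x v)

/-- `Λ` is a properly embedded (i.e. closed), orientable smooth submanifold of `ℂP^m`. As `ℂP^m` is
a compact embedded submanifold of the space of operators, it is the same to be
a (closed) embedded submanifold of either, for a subset of `ℂP^m`. -/
def IsProperSubmanifold {m : ℕ} (Λ : Set (V m →L[ℂ] V m)) : Prop :=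
  Λ ⊆ projectiveSpace m ∧ IsClosed Λ ∧ ∃ k : ℕ, IsOrientableSubmanifold Λ k

/-- The Bohr–Sommerfeld condition at level `p` for `Λ ⊆ ℂP^m`: it is a properly embedded orientable
submanifold over which `L^p` has a nowhere vanishing smooth section `ζ` with `∇ ζ = 0`. -/
def SatisfiesBohrSommerfeld {m : ℕ} (p : ℕ) (Λ : Set (V m →L[ℂ] V m)) : Prop :=
  IsProperSubmanifold Λ ∧
  ∃ ζ : (V m →L[ℂ] V m) → Forms m p,
    (∀ x ∈ Λ, ζ x ∈ lineBundleFibre p x) ∧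
    (∀ x ∈ Λ, ζ x ≠ 0) ∧
    IsSmoothAlong ζ Λ ∧
    ∀ x ∈ Λ, ∀ v ∈ tangentVectors Λ x, covariantDerivative Λ ζ x v = 0

end BohrSommerfeld

end

/-!
Write `ν_0 = 1 - ∑ ν_j`. The fibre `Λ_ν` is the set of all `Π_z` with `‖z_j‖² = ν_j` for every
`j = 0, …, m`: an orbit of the torus of diagonal unitary matrices. Fixing a coordinate `i` with
`ν_i > 0` and making `z_i` real, the phases of the other nonzero coordinates of `z` can be read off
from the `i`-th column of the matrix of `Π_z`. So they embed a torus `(S¹)ᵏ` in the space of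
operators with image `Λ_ν` (`injective_torusMap`, `range_torusMap`). The angles are local
coordinates; as all the charts are restrictions of one periodic map (`angularMap`), the coordinate
changes are translations, and `Λ_ν` is oriented (`isOrientableSubmanifold_torus`).

If `ζ` is a flat nowhere vanishing section of `L^p`, rotate the phase of `z_j` by `t ∈ [0, 2π]`.
Along this loop the value of `ζ` on `(z, …, z)` satisfies `f' = i p ν_j f`
(`hasDerivAt_flat_section`). As `f` is periodic and not zero, `p ν_j` is an integer.

Conversely, let all the `k_j = p ν_j` be integers, also for `j = 0`. They are natural numbers with
sum `p`, and the monomial `∏ z_j ^ k_j` of degree `p` gives the section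
`Π_z ↦ (∏ z_j ^ k_j) ⟨z, ·⟩ ⊗ ⋯ ⊗ ⟨z, ·⟩`. It is polynomial in `Π_z`, being the compression by `Π_z`
of a fixed `p`-linear form (`monomialForm`). It does not vanish on `Λ_ν`, since `k_j = 0` where
`z_j = 0`. It is flat there, since the logarithmic derivative of the monomial is
`∑ k_j y_j / z_j = p ∑ conj z_j y_j` (`sum_prod_erase_eq_zero`), while a curve `γ` of projections
starting at `Π_z` moves `γ z` orthogonally to `z` (`inner_velocity_eq_zero`).
-/

noncomputable section

namespace BohrSommerfeld

open Complex ComplexConjugate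

/-! ### The fibres of the moment map as torus orbits -/

/-- The homogeneous weights `(1 - ∑ ν_j, ν_1, …, ν_m)`: the squared moduli of all the coordinates
of a unit vector lying over `ν`. -/
def weights {m : ℕ} (ν : Fin m → ℝ) : Fin (m + 1) → ℝ := Fin.cons (1 - ∑ j, ν j) ν

theorem weights_succ {m : ℕ} (ν : Fin m → ℝ) (j : Fin m) : weights ν j.succ = ν j := rfl

theorem sum_weights {m : ℕ} (ν : Fin m → ℝ) : ∑ j, weights ν j = 1 := by
  simp [weights, Fin.sum_univ_succ]

theorem weights_nonneg {m : ℕ} {ν : Fin m → ℝ} (hν : ν ∈ simplex m) (j : Fin (m + 1)) :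
    0 ≤ weights ν j := by
  refine Fin.cases ?_ (fun i => ?_) j
  · simpa [weights] using hν.1
  · exact hν.2 i

/-- The vectors whose coordinates have squared moduli `w`: a product of circles and points. -/
def torus {m : ℕ} (w : Fin (m + 1) → ℝ) : Set (V m) := {z | ∀ j, ‖z j‖ ^ 2 = w j}

theorem norm_eq_one_of_mem_torus {m : ℕ} {ν : Fin m → ℝ} {z : V m} (hz : z ∈ torus (weights ν)) :
    ‖z‖ = 1 := by
  rw [EuclideanSpace.norm_eq, Finset.sum_congr rfl fun j _ => hz j, sum_weights, Real.sqrt_one]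

theorem momentFibre_eq_image {m : ℕ} (ν : Fin m → ℝ) :
    momentFibre ν = proj '' torus (weights ν) := by
  ext A
  constructor
  · rintro ⟨⟨z, hz, rfl⟩, h⟩
    have hs : ∀ j : Fin m, ‖z j.succ‖ ^ 2 = ν j := fun j => by rw [← momentMap_proj, h]
    refine ⟨z, Fin.cases ?_ hs, rfl⟩
    have h1 : ‖z‖ ^ 2 = 1 := by rw [hz, one_pow]
    rw [EuclideanSpace.norm_sq_eq, Fin.sum_univ_succ, Finset.sum_congr rfl fun j _ => hs j] at h1
    simp only [weights, Fin.cons_zero]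
    linarith
  · rintro ⟨z, hz, rfl⟩
    exact ⟨⟨z, norm_eq_one_of_mem_torus hz, rfl⟩, funext fun j => by
      rw [momentMap_proj, hz, weights_succ]⟩

theorem proj_apply {m : ℕ} (z v : V m) : proj z v = inner ℂ z v • z := rfl

theorem proj_self {m : ℕ} {z : V m} (hz : ‖z‖ = 1) : proj z z = z := by
  simp [proj_apply, inner_self_eq_norm_sq_to_K, hz]

theorem proj_single {m : ℕ} (z : V m) (i j : Fin (m + 1)) :
    proj z (EuclideanSpace.single i 1) j = conj (z i) * z j := by
  simp [proj_apply, EuclideanSpace.inner_single_right]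

theorem rankOne_real_smul {m : ℕ} (c : ℝ) (x y : V m) :
    (InnerProductSpace.rankOne ℂ x (c • y) : V m →L[ℂ] V m) =
      c • (InnerProductSpace.rankOne ℂ x y : V m →L[ℂ] V m) := by
  ext v : 1
  have h : inner ℂ (c • y) v = (c : ℂ) * inner ℂ y v := by
    rw [← Complex.coe_smul, inner_smul_left, Complex.conj_ofReal]
  rw [smul_apply, InnerProductSpace.rankOne_apply, InnerProductSpace.rankOne_apply, h, mul_smul,
    Complex.coe_smul]

theorem isBoundedBilinearMap_rankOne {m : ℕ} : IsBoundedBilinearMap ℝ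
    fun q : V m × V m => (InnerProductSpace.rankOne ℂ q.1 q.2 : V m →L[ℂ] V m) where
  add_left x y z := by simp
  smul_left c x y := by
    ext v : 1
    simp [InnerProductSpace.rankOne_apply, smul_comm c]
  add_right x y z := by simp
  smul_right c x y := rankOne_real_smul c x y
  bound := ⟨1, one_pos, fun x y => by simp⟩

theorem IsBoundedBilinearMap.contDiff_diagonal {E F : Type*} [NormedAddCommGroup E]
    [NormedSpace ℝ E] [NormedAddCommGroup F] [NormedSpace ℝ F] {B : E × E → F}
    (hB : IsBoundedBilinearMap ℝ B) : ContDiff ℝ ∞ fun x => B (x, x) :=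
  hB.contDiff.comp (contDiff_id.prodMk contDiff_id)

theorem contDiff_proj {m : ℕ} : ContDiff ℝ ∞ (proj : V m → V m →L[ℂ] V m) :=
  IsBoundedBilinearMap.contDiff_diagonal isBoundedBilinearMap_rankOne

theorem isClosed_momentFibre {m : ℕ} (ν : Fin m → ℝ) : IsClosed (momentFibre ν) := by
  rw [momentFibre_eq_image]
  refine (IsCompact.image ?_ contDiff_proj.continuous).isClosed
  refine Metric.isCompact_of_isClosed_isBounded ?_
    (Metric.isBounded_sphere (x := (0 : V m)) (r := 1) |>.subset fun z hz => ?_)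
  · simp only [torus, Set.ofPred_forall]
    exact isClosed_iInter fun j => isClosed_eq (by fun_prop) continuous_const
  · simpa using norm_eq_one_of_mem_torus hz

/-! ### Angular coordinates on a fibre -/

/-- The coordinates other than `i` with a positive weight. As `i` normalizes the phase, these
index the angular coordinates of the fibre, whose dimension is their number. -/
abbrev Angles {m : ℕ} (w : Fin (m + 1) → ℝ) (i : Fin (m + 1)) : Type :=
  {j : Fin (m + 1) // j ≠ i ∧ 0 < w j}

/-- The vector with moduli `√w` and phases `u`; its `i`-th coordinate is real, and so are the
coordinates of weight zero. -/
def torusVector {m : ℕ} (w : Fin (m + 1) → ℝ) (i : Fin (m + 1)) (u : Angles w i → Circle) :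
    V m :=
  WithLp.toLp 2 fun j => (√(w j) : ℂ) * if h : j ≠ i ∧ 0 < w j then (u ⟨j, h⟩ : ℂ) else 1

theorem torusVector_mem {m : ℕ} {w : Fin (m + 1) → ℝ} (hw : ∀ j, 0 ≤ w j) (i : Fin (m + 1))
    (u : Angles w i → Circle) : torusVector w i u ∈ torus w := by
  intro j
  have : ‖(if h : j ≠ i ∧ 0 < w j then (u ⟨j, h⟩ : ℂ) else 1)‖ = 1 := by
    split_ifs
    exacts [Circle.norm_coe _, norm_one]
  simp only [torusVector, norm_mul, this, mul_one, norm_real, Real.norm_eq_abs, sq_abs]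
  exact Real.sq_sqrt (hw j)

/-- The parametrization of the fibre by a torus `(S¹)ᵏ`. -/
def torusMap {m : ℕ} (w : Fin (m + 1) → ℝ) (i : Fin (m + 1)) (u : Angles w i → Circle) :
    V m →L[ℂ] V m := proj (torusVector w i u)

/-- Up to positive factors, the `i`-th column of the matrix of a point consists of its phases. -/
theorem torusMap_single {m : ℕ} (w : Fin (m + 1) → ℝ) (i : Fin (m + 1))
    (u : Angles w i → Circle) (j : Angles w i) :
    torusMap w i u (EuclideanSpace.single i 1) j = (√(w i) * √(w j) : ℝ) * (u j : ℂ) := by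
  simp [torusMap, proj_single, torusVector, j.2.1, j.2.2, mul_assoc]

theorem continuous_torusMap {m : ℕ} (w : Fin (m + 1) → ℝ) (i : Fin (m + 1)) :
    Continuous (torusMap w i) := by
  refine contDiff_proj.continuous.comp ((PiLp.continuous_toLp 2 _).comp ?_)
  refine continuous_pi fun j => continuous_const.mul ?_
  split_ifs <;> fun_prop

theorem injective_torusMap {m : ℕ} {w : Fin (m + 1) → ℝ} {i : Fin (m + 1)} (hi : 0 < w i) :
    Function.Injective (torusMap w i) := by
  intro u v h
  ext j
  have := congrArg (fun A => A (EuclideanSpace.single i 1) (j : Fin (m + 1))) h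
  simp only [torusMap_single] at this
  have h0 : ((√(w i) * √(w j) : ℝ) : ℂ) ≠ 0 :=
    ofReal_ne_zero.2 (mul_pos (Real.sqrt_pos.2 hi) (Real.sqrt_pos.2 j.2.2)).ne'
  exact mul_left_cancel₀ h0 this

theorem proj_smul {m : ℕ} (c : Circle) (z : V m) : proj ((c : ℂ) • z) = proj z := by
  ext v : 1
  rw [proj_apply, proj_apply, inner_smul_left, smul_smul, mul_right_comm,
    ← Complex.normSq_eq_conj_mul_self]
  simp

theorem range_torusMap {m : ℕ} {w : Fin (m + 1) → ℝ} (hw : ∀ j, 0 ≤ w j) {i : Fin (m + 1)}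
    (hi : 0 < w i) : Set.range (torusMap w i) = proj '' torus w := by
  refine Set.Subset.antisymm ?_ ?_
  · rintro _ ⟨u, rfl⟩
    exact ⟨_, torusVector_mem hw i u, rfl⟩
  · rintro _ ⟨z, hz, rfl⟩
    have hr : ∀ j, ((√(w j) : ℝ) : ℂ) = ‖z j‖ := fun j => by
      rw [← hz j, Real.sqrt_sq (norm_nonneg _)]
    have he : ∀ j, z j = (√(w j) : ℝ) * (Circle.exp (arg (z j)) : ℂ) := fun j => by
      rw [hr, Circle.coe_exp, norm_mul_exp_arg_mul_I]
    refine ⟨fun j => (Circle.exp (arg (z i)))⁻¹ * Circle.exp (arg (z j)), ?_⟩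
    rw [torusMap, ← proj_smul (Circle.exp (arg (z i)))]
    congr 1
    ext j
    have hc : (Circle.exp (arg (z i)) : ℂ) ≠ 0 := Circle.coe_ne_zero _
    by_cases h : j ≠ i ∧ 0 < w j
    · conv_rhs => rw [he j]
      simp only [torusVector, PiLp.smul_apply, smul_eq_mul, dif_pos h, Circle.coe_mul,
        Circle.coe_inv]
      field_simp
    · simp only [torusVector, PiLp.smul_apply, smul_eq_mul, dif_neg h, mul_one]
      by_cases hj : j = i
      · subst hj
        rw [mul_comm]
        exact (he j).symm
      · have : w j = 0 := le_antisymm (not_lt.1 fun h' => h ⟨hj, h'⟩) (hw j)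
        rw [he j, this]
        simp

/-- The angular parametrization of the fibre. It is `2π`-periodic in each variable; its
restrictions to small balls are the charts of the fibre. -/
def angularMap {m k : ℕ} (w : Fin (m + 1) → ℝ) (i : Fin (m + 1)) (e : Angles w i ≃ Fin k)
    (θ : EuclideanSpace ℝ (Fin k)) : V m →L[ℂ] V m :=
  torusMap w i fun j => Circle.exp (θ (e j))

theorem contDiff_angularMap {m k : ℕ} (w : Fin (m + 1) → ℝ) (i : Fin (m + 1))
    (e : Angles w i ≃ Fin k) : ContDiff ℝ ∞ (angularMap w i e) := by
  refine contDiff_proj.comp ((contDiff_piLp 2).2 fun j => ?_)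
  refine contDiff_const.mul ?_
  split_ifs with h
  · simp only [Circle.coe_exp]
    have : ContDiff ℝ ∞ fun θ : EuclideanSpace ℝ (Fin k) => θ (e ⟨j, h⟩) := by fun_prop
    exact ((ofRealCLM.contDiff.comp this).mul contDiff_const).cexp
  · exact contDiff_const

theorem hasDerivAt_line {E F : Type*} [NormedAddCommGroup E] [NormedSpace ℝ E]
    [NormedAddCommGroup F] [NormedSpace ℝ F] {f : E → F} {x : E} (hf : DifferentiableAt ℝ f x)
    (v : E) (ℓ : F →L[ℝ] ℂ) :
    HasDerivAt (fun t : ℝ => ℓ (f (x + t • v))) (ℓ (fderiv ℝ f x v)) 0 := by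
  have h1 : HasFDerivAt f (fderiv ℝ f x) (x + (0 : ℝ) • v) := by
    simpa using hf.hasFDerivAt
  have h2 : HasDerivAt (fun t : ℝ => x + t • v) v 0 := by
    simpa using ((hasDerivAt_id (0 : ℝ)).smul_const v).const_add x
  exact ℓ.hasFDerivAt.comp_hasDerivAt (0 : ℝ) (h1.comp_hasDerivAt (0 : ℝ) h2)

theorem injective_fderiv_angularMap {m k : ℕ} {w : Fin (m + 1) → ℝ} {i : Fin (m + 1)}
    (hi : 0 < w i) (e : Angles w i ≃ Fin k) (θ : EuclideanSpace ℝ (Fin k)) :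
    Function.Injective (fderiv ℝ (angularMap w i e) θ) := by
  rw [injective_iff_map_eq_zero]
  intro v hv
  ext l
  obtain ⟨j, rfl⟩ := e.surjective l
  -- The matrix entry carrying the phase `exp (i θ_j)` has derivative zero along `v`.
  let ℓ : (V m →L[ℂ] V m) →L[ℝ] ℂ := ((EuclideanSpace.proj (𝕜 := ℂ) (j : Fin (m + 1))).comp
    (ContinuousLinearMap.apply ℂ (V m) (EuclideanSpace.single i (1 : ℂ)))).restrictScalars ℝ
  have h3 : HasDerivAt (fun t : ℝ => ((√(w i) * √(w j) : ℝ) : ℂ) *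
      cexp (((θ (e j) + t * v (e j) : ℝ) : ℂ) * I)) 0 0 := by
    have := hasDerivAt_line ((contDiff_angularMap w i e).differentiable (by simp) θ) v ℓ
    rw [hv, map_zero] at this
    exact this.congr_of_eventuallyEq (Filter.Eventually.of_forall fun t =>
      (torusMap_single w i (fun j => Circle.exp ((θ + t • v) (e j))) j).symm)
  have h4 : HasDerivAt (fun t : ℝ => ((√(w i) * √(w j) : ℝ) : ℂ) *
      cexp (((θ (e j) + t * v (e j) : ℝ) : ℂ) * I))
      (((√(w i) * √(w j) : ℝ) : ℂ) * (cexp (((θ (e j) + 0 * v (e j) : ℝ) : ℂ) * I) *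
        ((v (e j) : ℂ) * I))) 0 := by
    refine HasDerivAt.const_mul _ (HasDerivAt.cexp (HasDerivAt.mul_const ?_ I))
    have : HasDerivAt (fun t : ℝ => θ (e j) + t * v (e j)) (v (e j)) 0 := by
      simpa using ((hasDerivAt_id (0 : ℝ)).mul_const (v (e j))).const_add (θ (e j))
    exact this.ofReal_comp
  have h0 : ((√(w i) * √(w j) : ℝ) : ℂ) ≠ 0 :=
    ofReal_ne_zero.2 (mul_pos (Real.sqrt_pos.2 hi) (Real.sqrt_pos.2 j.2.2)).ne'
  have := h4.unique h3
  simpa [h0, -ofReal_mul] using this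

/-- Points with the same image differ by a period, so the derivatives agree. -/
theorem fderiv_angularMap_eq {m k : ℕ} {w : Fin (m + 1) → ℝ} {i : Fin (m + 1)}
    (hi : 0 < w i) (e : Angles w i ≃ Fin k) {a b : EuclideanSpace ℝ (Fin k)}
    (h : angularMap w i e a = angularMap w i e b) :
    fderiv ℝ (angularMap w i e) a = fderiv ℝ (angularMap w i e) b := by
  have hp : (fun θ => angularMap w i e (θ + (b - a))) = angularMap w i e := by
    funext θ
    refine congrArg (torusMap w i) (funext fun j => ?_)
    have hj : Circle.exp (a (e j)) = Circle.exp (b (e j)) := congrFun (injective_torusMap hi h) j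
    simp [Circle.exp_add, Circle.exp_sub, hj]
  conv_lhs => rw [← hp, fderiv_comp_add_right, add_sub_cancel]

/-- On a ball of radius `π` every angle stays in an interval of length `2π`, where the phase
determines it. -/
theorem isOpenEmbedding_exp_ball {ι κ : Type*} [Fintype ι] [Finite κ] (e : κ ≃ ι)
    (c : EuclideanSpace ℝ ι) : Topology.IsOpenEmbedding
      ((Metric.ball c Real.pi).domRestrict fun θ (j : κ) => Circle.exp (θ (e j))) := by
  refine Topology.isOpenEmbedding_iff_continuous_injective_isOpenMap.2 ⟨?_, ?_, ?_⟩
  · refine Continuous.comp (g := fun (θ : EuclideanSpace ℝ ι) (j : κ) => Circle.exp (θ (e j)))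
      (by fun_prop) continuous_subtype_val
  · rintro ⟨x, hx⟩ ⟨y, hy⟩ h
    refine Subtype.ext (PiLp.ext fun l => ?_)
    obtain ⟨j, rfl⟩ := e.surjective l
    have hx' := (PiLp.norm_apply_le (x - c) (e j)).trans_lt (mem_ball_iff_norm.1 hx)
    have hy' := (PiLp.norm_apply_le (y - c) (e j)).trans_lt (mem_ball_iff_norm.1 hy)
    simp only [PiLp.sub_apply, Real.norm_eq_abs, abs_lt] at hx' hy'
    refine Circle.exp_injOn_Ico (a := c (e j) - Real.pi) (b := c (e j) + Real.pi) (by linarith)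
      ⟨by linarith, by linarith⟩ ⟨by linarith, by linarith⟩ (congrFun h j)
  · have h1 : IsOpenMap fun (θ : EuclideanSpace ℝ ι) (j : κ) => Circle.exp (θ (e j)) := by
      have hπ : IsOpenMap (Pi.map fun _ : κ => (Circle.exp : ℝ → Circle)) :=
        IsOpenMap.piMap (fun _ => isLocalHomeomorph_circleExp.isOpenMap)
          (Filter.Eventually.of_forall fun _ => Circle.exp_surjective)
      exact hπ.comp (((Homeomorph.piCongrLeft (Y := fun _ => ℝ) e).symm.isOpenMap).comp
        (PiLp.homeomorph 2 fun _ : ι => ℝ).isOpenMap)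
    exact h1.domRestrict Metric.isOpen_ball

/-- The chart of the fibre given by the angular coordinates in the ball of radius `π`
about `c`. -/
def angularChart {m k : ℕ} {w : Fin (m + 1) → ℝ} (hw : ∀ j, 0 ≤ w j) {i : Fin (m + 1)}
    (hi : 0 < w i) (e : Angles w i ≃ Fin k) (c : EuclideanSpace ℝ (Fin k)) :
    LocalParametrization (proj '' torus w) k where
  toFun := angularMap w i e
  source := Metric.ball c Real.pi
  isOpen_source := Metric.isOpen_ball
  contDiffOn := (contDiff_angularMap w i e).contDiffOn
  injective_fderiv := fun a _ => injective_fderiv_angularMap hi e a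
  isEmbedding :=
    ((continuous_torusMap w i).isClosedEmbedding (injective_torusMap hi)).isEmbedding.comp
      (isOpenEmbedding_exp_ball e c).isEmbedding
  image_eq := by
    have ht := ((continuous_torusMap w i).isClosedEmbedding (injective_torusMap hi)).isInducing
    obtain ⟨U, hU, hU'⟩ := ht.isOpen_iff.1 (isOpenEmbedding_exp_ball e c).isOpen_range
    refine ⟨U, hU, ?_⟩
    rw [← range_torusMap hw hi, ← Set.image_preimage_eq_inter_range, hU', Set.range_domRestrict,
      Set.image_image]
    rfl

theorem isOrientableSubmanifold_torus {m : ℕ} {w : Fin (m + 1) → ℝ} (hw : ∀ j, 0 ≤ w j)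
    {i : Fin (m + 1)} (hi : 0 < w i) :
    IsOrientableSubmanifold (proj '' torus w : Set (V m →L[ℂ] V m))
      (Fintype.card (Angles w i)) := by
  let e := Fintype.equivFin (Angles w i)
  refine ⟨Set.range (angularChart hw hi e), ?_, ?_⟩
  · intro x hx
    rw [← range_torusMap hw hi] at hx
    obtain ⟨u, rfl⟩ := hx
    let c : EuclideanSpace ℝ (Fin (Fintype.card (Angles w i))) :=
      WithLp.toLp 2 fun l => arg (u (e.symm l))
    refine ⟨_, ⟨c, rfl⟩, c, Metric.mem_ball_self Real.pi_pos, ?_⟩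
    refine congrArg (torusMap w i) (funext fun j => ?_)
    simp [c, Circle.exp_arg]
  · -- All charts restrict the same periodic map, so the coordinate changes are translations.
    rintro _ ⟨c, rfl⟩ _ ⟨d, rfl⟩ a _ b _ h
    refine ⟨ContinuousLinearMap.id ℝ _, ?_, by simp [ContinuousLinearMap.det]⟩
    rw [ContinuousLinearMap.comp_id]
    exact fderiv_angularMap_eq hi e h

theorem isProperSubmanifold_momentFibre {m : ℕ} {ν : Fin m → ℝ} (hν : ν ∈ simplex m) :
    IsProperSubmanifold (momentFibre ν) := by
  refine ⟨fun A hA => hA.1, isClosed_momentFibre ν, ?_⟩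
  obtain ⟨i, -, hi⟩ := Finset.exists_lt_of_sum_lt (s := Finset.univ) (f := fun _ => (0 : ℝ))
    (g := weights ν) (by simp [sum_weights])
  rw [momentFibre_eq_image]
  exact ⟨_, isOrientableSubmanifold_torus (weights_nonneg hν) hi⟩

/-! ### Differentiation of sections along curves -/

/-- On velocities of curves in `Λ`, the (possibly not unique) derivative within `Λ` is the
derivative along the curve. -/
theorem hasDerivAt_along {E F : Type*} [NormedAddCommGroup E] [NormedSpace ℝ E]
    [NormedAddCommGroup F] [NormedSpace ℝ F] {ζ : E → F} {Λ : Set E} {γ : ℝ → E} {v : E} {s : ℝ}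
    (hγ : HasDerivAt γ v s) (hΛ : ∀ t, γ t ∈ Λ) (hζ : IsSmoothAlong ζ Λ) (ℓ : F →L[ℝ] ℂ) :
    HasDerivAt (fun t => ℓ (ζ (γ t))) (ℓ (fderivWithin ℝ ζ Λ (γ s) v)) s := by
  obtain ⟨U, hU, hxU, g, hg, he⟩ := hζ (γ s) (hΛ s)
  have hd : DifferentiableWithinAt ℝ ζ Λ (γ s) := by
    have h1 : DifferentiableWithinAt ℝ g Λ (γ s) :=
      ((hg.contDiffAt (hU.mem_nhds hxU)).differentiableAt (by simp)).differentiableWithinAt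
    refine h1.congr_of_eventuallyEq ?_ (he ⟨hxU, hΛ s⟩)
    filter_upwards [self_mem_nhdsWithin, mem_nhdsWithin_of_mem_nhds (hU.mem_nhds hxU)] with y hy hyU
    exact he ⟨hyU, hy⟩
  exact ℓ.hasFDerivAt.comp_hasDerivAt s
    (hd.hasFDerivWithinAt.comp_hasDerivAt s hγ (Filter.Eventually.of_forall hΛ))

/-- Evaluation of `p`-linear forms at a fixed tuple, as a functional over `ℝ`, the field over
which sections are differentiated. -/
def evalForm {m p : ℕ} (u : Fin p → V m) : Forms m p →L[ℝ] ℂ :=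
  (ContinuousMultilinearMap.apply ℂ (fun _ : Fin p => V m) ℂ u).restrictScalars ℝ

theorem evalForm_apply {m p : ℕ} (u : Fin p → V m) (α : Forms m p) : evalForm u α = α u := rfl

theorem compress_apply {m p : ℕ} (A : V m →L[ℂ] V m) (α : Forms m p) (u : Fin p → V m) :
    compress A α u = α fun i => A (u i) := rfl

/-- An element of the fibre of `L^p` at `Π_z` is determined by its value on `z`. -/
theorem form_apply_of_mem_fibre {m p : ℕ} {z : V m} {α : Forms m p}
    (hα : α ∈ lineBundleFibre p (proj z)) (u : Fin p → V m) :
    α u = (∏ i, inner ℂ z (u i)) * α fun _ => z := by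
  rw [← hα u]
  simp only [proj_apply]
  rw [α.map_smul_univ, smul_eq_mul]

/-! ### Holonomy along the torus orbits -/

/-- Multiplication of the `j`-th coordinate by `exp (i t)`. -/
def rotate {m : ℕ} (j : Fin (m + 1)) (t : ℝ) (z : V m) : V m :=
  z + ((cexp (t * I) - 1) * z j) • EuclideanSpace.single j (1 : ℂ)

theorem norm_rotate_apply {m : ℕ} (j : Fin (m + 1)) (t : ℝ) (z : V m) (l : Fin (m + 1)) :
    ‖rotate j t z l‖ = ‖z l‖ := by
  by_cases h : l = j
  · subst h
    have : rotate l t z l = cexp (t * I) * z l := by simp [rotate]; ring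
    rw [this, norm_mul, norm_exp_ofReal_mul_I, one_mul]
  · simp [rotate, h]

theorem rotate_two_pi {m : ℕ} (j : Fin (m + 1)) (z : V m) :
    rotate j (2 * Real.pi) z = rotate j 0 z := by
  simp [rotate, exp_two_pi_mul_I]

theorem inner_rotate {m : ℕ} {z : V m} (hz : ‖z‖ = 1) (j : Fin (m + 1)) (t s : ℝ) :
    inner ℂ (rotate j t z) (rotate j s z) =
      1 + (‖z j‖ ^ 2 : ℝ) * (cexp (((s - t : ℝ) : ℂ) * I) - 1) := by
  have h1 : cexp (((s - t : ℝ) : ℂ) * I) = cexp (s * I) * conj (cexp (t * I)) := by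
    rw [← exp_conj, ← exp_add]
    simp [add_mul, sub_eq_add_neg]
  have h2 : (((‖z j‖ ^ 2 : ℝ)) : ℂ) = z j * conj (z j) := by
    rw [mul_conj, normSq_eq_norm_sq]
  rw [h1, h2]
  simp only [rotate, inner_add_left, inner_add_right, inner_smul_left, inner_smul_right,
    EuclideanSpace.inner_single_left, EuclideanSpace.inner_single_right,
    inner_self_eq_norm_sq_to_K, hz, map_mul, map_sub, map_one]
  simp
  ring

theorem contDiff_rotate {m : ℕ} (j : Fin (m + 1)) (z : V m) :
    ContDiff ℝ ∞ fun t : ℝ => rotate j t z := by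
  have h : ContDiff ℝ ∞ fun t : ℝ => (cexp (t * I) - 1) * z j :=
    ((ofRealCLM.contDiff.mul contDiff_const).cexp.sub contDiff_const).mul contDiff_const
  exact contDiff_const.add (h.smul contDiff_const)

/-- Along the rotation of the `j`-th coordinate of `z`, the connection form of the tautological
bundle is `⟨z, z'⟩ = i ‖z_j‖²`, so that the value on the moving vector of a flat section of `L^p`
satisfies the linear equation `f' = i p ‖z_j‖² f`. -/
theorem hasDerivAt_flat_section {m p : ℕ} {Λ : Set (V m →L[ℂ] V m)}
    {ζ : (V m →L[ℂ] V m) → Forms m p} (hfib : ∀ x ∈ Λ, ζ x ∈ lineBundleFibre p x)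
    (hζ : IsSmoothAlong ζ Λ)
    (hflat : ∀ x ∈ Λ, ∀ v ∈ tangentVectors Λ x, covariantDerivative Λ ζ x v = 0)
    {z : V m} (hz : ‖z‖ = 1) (j : Fin (m + 1)) (hΛ : ∀ t, proj (rotate j t z) ∈ Λ) (s : ℝ) :
    HasDerivAt (fun t => ζ (proj (rotate j t z)) fun _ => rotate j t z)
      (p * ‖z j‖ ^ 2 * I * ζ (proj (rotate j s z)) fun _ => rotate j s z) s := by
  set f : ℝ → ℂ := fun t => ζ (proj (rotate j t z)) fun _ => rotate j t z
  have hc : ContDiff ℝ ∞ fun t => proj (rotate j t z) := contDiff_proj.comp (contDiff_rotate j z)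
  obtain ⟨v, hv⟩ : ∃ v, HasDerivAt (fun t => proj (rotate j t z)) v s :=
    ⟨_, (hc.differentiable (by simp) s).hasDerivAt⟩
  have hs : ‖rotate j s z‖ = 1 := by
    rw [← hz, EuclideanSpace.norm_eq, EuclideanSpace.norm_eq]
    simp only [norm_rotate_apply]
  have hvt : v ∈ tangentVectors Λ (proj (rotate j s z)) := by
    refine ⟨fun t => proj (rotate j (t + s) z), hc.comp (contDiff_id.add contDiff_const),
      fun t => hΛ _, by simp, ?_⟩
    exact HasDerivAt.comp_add_const (f := fun t => proj (rotate j t z)) 0 s (by simpa using hv)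
  -- The values of `ζ` on the fixed vector `rotate j s z` have derivative zero at `s`; they differ
  -- from `f` by a power of the pairing `g` of this vector with the moving one.
  let g : ℝ → ℂ := fun t => inner ℂ (rotate j t z) (rotate j s z)
  have hL : HasDerivAt (fun t => g t ^ p * f t) 0 s := by
    have h := hasDerivAt_along hv hΛ hζ (evalForm fun _ : Fin p => rotate j s z)
    have h0 : evalForm (fun _ : Fin p => rotate j s z)
        (fderivWithin ℝ ζ Λ (proj (rotate j s z)) v) = 0 := by
      have := congrArg (fun α => α fun _ => rotate j s z) (hflat _ (hΛ s) v hvt)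
      rw [evalForm_apply]
      simpa [covariantDerivative, compress_apply, proj_self hs] using this
    rw [h0] at h
    refine h.congr_of_eventuallyEq (Filter.Eventually.of_forall fun t => ?_)
    simp only [evalForm_apply, f, g]
    rw [form_apply_of_mem_fibre (hfib _ (hΛ t)) fun _ => rotate j s z, Finset.prod_const,
      Finset.card_univ, Fintype.card_fin]
  have hgs : g s = 1 := by simp [g, inner_rotate hz]
  have hg : HasDerivAt g (-(‖z j‖ ^ 2 * I)) s := by
    have h1 : HasDerivAt (fun t : ℝ => ((s - t : ℝ) : ℂ)) ((-1 : ℝ) : ℂ) s := by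
      exact ((hasDerivAt_id s).const_sub s).ofReal_comp
    have h2 := ((((h1.mul_const I).cexp).sub_const 1).const_mul ((‖z j‖ ^ 2 : ℝ) : ℂ)).const_add 1
    have h3 : g = fun t => 1 + ((‖z j‖ ^ 2 : ℝ) : ℂ) * (cexp (((s - t : ℝ) : ℂ) * I) - 1) :=
      funext fun t => inner_rotate hz j t s
    rw [h3]
    convert! h2 using 1
    simp
  have hne : ∀ᶠ t in nhds s, g t ≠ 0 :=
    hg.continuousAt.eventually_ne (by rw [hgs]; exact one_ne_zero)
  have hq := hL.fun_div (hg.fun_pow p) (pow_ne_zero p (hgs.symm ▸ one_ne_zero))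
  have hf : HasDerivAt f _ s := hq.congr_of_eventuallyEq (hne.mono fun t ht =>
    (mul_div_cancel_left₀ _ (pow_ne_zero p ht)).symm)
  convert! hf using 1
  simp [hgs, f]
  ring

/-- Parallel transport around the circle rotating the `j`-th coordinate is multiplication by
`exp (2π i p ‖z_j‖²)`, which must be trivial if there is a flat section. -/
theorem exists_int_of_flat_section {m p : ℕ} {Λ : Set (V m →L[ℂ] V m)}
    {ζ : (V m →L[ℂ] V m) → Forms m p} (hfib : ∀ x ∈ Λ, ζ x ∈ lineBundleFibre p x)
    (hne : ∀ x ∈ Λ, ζ x ≠ 0) (hζ : IsSmoothAlong ζ Λ)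
    (hflat : ∀ x ∈ Λ, ∀ v ∈ tangentVectors Λ x, covariantDerivative Λ ζ x v = 0)
    {z : V m} (hz : ‖z‖ = 1) (j : Fin (m + 1)) (hΛ : ∀ t, proj (rotate j t z) ∈ Λ) :
    ∃ k : ℤ, (p : ℝ) * ‖z j‖ ^ 2 = k := by
  set f : ℝ → ℂ := fun t => ζ (proj (rotate j t z)) fun _ => rotate j t z
  set c : ℂ := p * ‖z j‖ ^ 2 * I
  have hf : ∀ s, HasDerivAt f (c * f s) s := fun s =>
    hasDerivAt_flat_section hfib hζ hflat hz j hΛ s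
  have hd : ∀ s : ℝ, HasDerivAt (fun t : ℝ => cexp (-(t * c)) * f t) 0 s := by
    intro s
    have h1 : HasDerivAt (fun t : ℝ => -((t : ℂ) * c)) (-c) s := by
      simpa using ((hasDerivAt_id s).ofReal_comp.mul_const c).fun_neg
    convert! h1.cexp.fun_mul (hf s) using 1
    ring
  have hconst := is_const_of_deriv_eq_zero (fun s => (hd s).differentiableAt)
    (fun s => (hd s).deriv) (2 * Real.pi) 0
  have hper : f (2 * Real.pi) = f 0 := by simp only [f, rotate_two_pi]
  have hf0 : f 0 ≠ 0 := fun h => hne _ (hΛ 0) (by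
    ext u
    rw [form_apply_of_mem_fibre (hfib _ (hΛ 0)) u]
    exact mul_eq_zero_of_right _ h)
  rw [hper] at hconst
  have he := mul_right_cancel₀ hf0 hconst
  simp only [ofReal_zero, zero_mul, neg_zero, exp_zero] at he
  obtain ⟨n, hn⟩ := exp_eq_one_iff.1 he
  refine ⟨-n, ?_⟩
  have hpi : (2 * Real.pi * I : ℂ) ≠ 0 := two_pi_I_ne_zero
  have : ((p * ‖z j‖ ^ 2 : ℝ) : ℂ) = ((-n : ℤ) : ℝ) := by
    refine mul_right_cancel₀ hpi ?_
    push_cast at hn ⊢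
    linear_combination -hn
  exact_mod_cast this

/-- The loops that rotate one coordinate stay in the fibre, and their holonomies
`exp (2π i p ν_j)` have to be trivial. -/
theorem mem_scaledLattice_of_flat_section {m p : ℕ} (hp : 0 < p) {ν : Fin m → ℝ}
    (hν : ν ∈ simplex m) (h : SatisfiesBohrSommerfeld p (momentFibre ν)) :
    ν ∈ scaledLattice m p := by
  obtain ⟨-, ζ, hfib, hne, hζ, hflat⟩ := h
  let z : V m := WithLp.toLp 2 fun j => (√(weights ν j) : ℂ)
  have hz : z ∈ torus (weights ν) := fun j => by simp [z, Real.sq_sqrt (weights_nonneg hν j)]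
  have hΛ : ∀ j t, proj (rotate j t z) ∈ momentFibre ν := fun j t => by
    rw [momentFibre_eq_image]
    exact ⟨_, fun l => by rw [norm_rotate_apply, hz], rfl⟩
  choose k hk using fun j => exists_int_of_flat_section hfib hne hζ hflat
    (norm_eq_one_of_mem_torus hz) j (hΛ j)
  refine ⟨fun j => k j.succ, fun j => ?_⟩
  have hp' : (p : ℝ) ≠ 0 := Nat.cast_ne_zero.2 hp.ne'
  rw [← hk, hz, weights_succ]
  field_simp

/-! ### The monomial section -/

/-- The `p`-linear form `(u_1, …, u_p) ↦ ∏ (u_i)_{σ i}`. -/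
def monomialForm {m p : ℕ} (σ : Fin p → Fin (m + 1)) : Forms m p :=
  (ContinuousMultilinearMap.mkPiAlgebra ℂ (Fin p) ℂ).compContinuousLinearMap
    fun i => EuclideanSpace.proj (σ i)

theorem monomialForm_apply {m p : ℕ} (σ : Fin p → Fin (m + 1)) (u : Fin p → V m) :
    monomialForm σ u = ∏ i, u i (σ i) := rfl

theorem contDiff_compContinuousLinearMap_const {p : ℕ} {E : Type*} [NormedAddCommGroup E]
    [NormedSpace ℂ E] (α : ContinuousMultilinearMap ℂ (fun _ : Fin p => E) ℂ) :
    ContDiff ℂ ∞ fun A : E →L[ℂ] E => α.compContinuousLinearMap fun _ => A := by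
  have h : ContDiff ℂ ∞ fun A : E →L[ℂ] E => ((fun _ : Fin p => A), α) :=
    (contDiff_pi.2 fun _ => contDiff_id).prodMk contDiff_const
  exact contDiff_iff_contDiffAt.2 fun A =>
    (ContinuousMultilinearMap.analyticAt_uncurry_compContinuousLinearMap.contDiffAt).comp A
      h.contDiffAt

theorem contDiff_compress {m p : ℕ} (α : Forms m p) :
    ContDiff ℝ ∞ fun A : V m →L[ℂ] V m => compress A α :=
  (contDiff_compContinuousLinearMap_const α).restrict_scalars ℝ

theorem proj_comp_self {m : ℕ} {z : V m} (hz : ‖z‖ = 1) (u : V m) :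
    proj z (proj z u) = proj z u := by
  rw [proj_apply z u, map_smul, proj_self hz]

theorem compress_mem_fibre {m p : ℕ} {z : V m} (hz : ‖z‖ = 1) (α : Forms m p) :
    compress (proj z) α ∈ lineBundleFibre p (proj z) := fun u => by
  simp only [compress_apply, proj_comp_self hz]

/-- A curve of rank-one projections through `Π_z` moves `z` orthogonally to itself at first
order. -/
theorem inner_velocity_eq_zero {m : ℕ} {γ : ℝ → V m →L[ℂ] V m}
    (hγ : ∀ t, γ t ∈ projectiveSpace m) {z y : V m} (hz : ‖z‖ = 1) (h0 : γ 0 = proj z)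
    (hy : HasDerivAt (fun t => γ t z) y 0) : inner ℂ z y = 0 := by
  -- `‖Π z‖² = ⟨z, Π z⟩` for every orthogonal projection `Π`.
  have he : ∀ t, inner ℂ (γ t z) (γ t z) - inner ℂ z (γ t z) = 0 := by
    intro t
    obtain ⟨x, hx, h⟩ := hγ t
    rw [h, proj_apply]
    rw [inner_smul_left, inner_smul_right, inner_smul_right, inner_self_eq_norm_sq_to_K, hx,
      inner_conj_symm]
    simp [mul_comm]
  have h1 := (hy.inner ℂ hy).sub ((hasDerivAt_const (0 : ℝ) z).inner ℂ hy)
  have h2 := h1.unique ((hasDerivAt_const (0 : ℝ) (0 : ℂ)).congr_of_eventuallyEq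
    (Filter.Eventually.of_forall he))
  rw [h0, proj_self hz] at h2
  have h3 : inner ℂ y z = 0 := by simpa using h2
  rw [← inner_conj_symm, h3, map_zero]

theorem exists_nat_of_mem_scaledLattice {m p : ℕ} (hp : 0 < p) {ν : Fin m → ℝ}
    (hν : ν ∈ simplex m) (h : ν ∈ scaledLattice m p) :
    ∃ k : Fin (m + 1) → ℕ, ∀ j, (k j : ℝ) = p * weights ν j := by
  obtain ⟨k, hk⟩ := h
  have hp' : (p : ℝ) ≠ 0 := Nat.cast_ne_zero.2 hp.ne'
  have hk' : ∀ j, p * ν j = k j := fun j => by rw [hk]; field_simp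
  have hz : ∀ j, ∃ n : ℤ, (n : ℝ) = p * weights ν j := by
    refine Fin.cases ⟨p - ∑ j, k j, ?_⟩ fun j => ⟨k j, by rw [weights_succ, hk']⟩
    simp only [weights, Fin.cons_zero, mul_sub, mul_one, Finset.mul_sum, hk']
    push_cast
    rfl
  choose n hn using hz
  refine ⟨fun j => (n j).toNat, fun j => ?_⟩
  have h0 : 0 ≤ n j := by
    have := mul_nonneg p.cast_nonneg (weights_nonneg hν j)
    rw [← hn] at this
    exact_mod_cast this
  rw [← hn]
  exact_mod_cast Int.toNat_of_nonneg h0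

/-- A word of length `p = ∑ k_j` containing the letter `j` exactly `k_j` times. -/
theorem exists_word {ι : Type*} [Fintype ι] {p : ℕ} {k : ι → ℕ} (hk : ∑ j, k j = p) :
    ∃ σ : Fin p → ι, (∀ i, k (σ i) ≠ 0) ∧
      ∀ g : ι → ℂ, ∑ i, g (σ i) = ∑ j, k j * g j := by
  let e : Fin p ≃ Σ j, Fin (k j) := Fintype.equivOfCardEq (by simp [hk])
  refine ⟨fun i => (e i).1, fun i => (Nat.zero_le _ |>.trans_lt (e i).2.2).ne', fun g => ?_⟩
  rw [Equiv.sum_comp e (fun x => g x.1), Fintype.sum_sigma]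
  simp

/-- If `k_j = p ‖z_j‖²`, then the monomial `∏ z_j ^ k_j`, written as the product over a word, has
derivative zero in every direction `y` orthogonal to `z`: its logarithmic derivative is
`∑ k_j y_j / z_j = p ⟨z, y⟩`. -/
theorem sum_prod_erase_eq_zero {ι : Type*} [Fintype ι] {p : ℕ} {k : ι → ℕ} {σ : Fin p → ι}
    (hσ : ∀ i, k (σ i) ≠ 0) (hσ' : ∀ g : ι → ℂ, ∑ i, g (σ i) = ∑ j, k j * g j)
    {z y : ι → ℂ} (hz : ∀ j, (k j : ℝ) = p * ‖z j‖ ^ 2) (hy : ∑ j, conj (z j) * y j = 0) :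
    ∑ i, (∏ l ∈ Finset.univ.erase i, z (σ l)) * y (σ i) = 0 := by
  have hne : ∀ i, z (σ i) ≠ 0 := fun i h => hσ i (by
    have := hz (σ i)
    rw [h] at this
    simpa using this)
  have h1 : ∀ i, (∏ l ∈ Finset.univ.erase i, z (σ l)) * y (σ i) =
      (∏ l, z (σ l)) * (y (σ i) / z (σ i)) := fun i => by
    rw [← Finset.mul_prod_erase _ _ (Finset.mem_univ i)]
    field_simp [hne i]
  have h2 : ∀ j, (k j : ℂ) * (y j / z j) = p * (conj (z j) * y j) := fun j => by
    have hk : (k j : ℂ) = p * (z j * conj (z j)) := by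
      rw [mul_conj, normSq_eq_norm_sq]
      exact_mod_cast hz j
    by_cases h : z j = 0
    · simp [h]
    · rw [hk]
      field_simp
  rw [Finset.sum_congr rfl fun i _ => h1 i, ← Finset.mul_sum, hσ' fun j => y j / z j,
    Finset.sum_congr rfl fun j _ => h2 j, ← Finset.mul_sum, hy, mul_zero, mul_zero]

/-- The section `Π_z ↦ (u ↦ ∏ z_{σ i} ⟨z, u_i⟩)`, with `σ` a word containing `p ν_j` times the
letter `j`, is flat over the fibre. -/
theorem satisfiesBohrSommerfeld_of_mem_scaledLattice {m p : ℕ} (hp : 0 < p) {ν : Fin m → ℝ}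
    (hν : ν ∈ simplex m) (h : ν ∈ scaledLattice m p) :
    SatisfiesBohrSommerfeld p (momentFibre ν) := by
  refine ⟨isProperSubmanifold_momentFibre hν, ?_⟩
  obtain ⟨k, hk⟩ := exists_nat_of_mem_scaledLattice hp hν h
  have hsum : ∑ j, k j = p := by
    have : ((∑ j, k j : ℕ) : ℝ) = p := by
      rw [Nat.cast_sum, Finset.sum_congr rfl fun j _ => hk j, ← Finset.mul_sum, sum_weights,
        mul_one]
    exact_mod_cast this
  obtain ⟨σ, hσ, hσ'⟩ := exists_word hsum
  have hsm : IsSmoothAlong (fun A => compress A (monomialForm σ)) (momentFibre ν) := fun x _ =>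
    ⟨Set.univ, isOpen_univ, trivial, _, (contDiff_compress _).contDiffOn, fun _ _ => rfl⟩
  refine ⟨fun A => compress A (monomialForm σ), ?_, ?_, hsm, ?_⟩
  · rintro _ ⟨⟨z, hz, rfl⟩, -⟩
    exact compress_mem_fibre hz _
  · intro x hx h0
    rw [momentFibre_eq_image] at hx
    obtain ⟨z, hz, rfl⟩ := hx
    have := congrArg (fun α : Forms m p => α fun _ => z) h0
    simp only [compress_apply, proj_self (norm_eq_one_of_mem_torus hz), monomialForm_apply] at this
    obtain ⟨i, -, hi⟩ := Finset.prod_eq_zero_iff.1 (this : ∏ i, z (σ i) = 0)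
    refine hσ i ?_
    have hki := hk (σ i)
    rw [← hz, hi] at hki
    simpa using hki
  · rintro x hx v ⟨γ, -, hγ, hγ0, hv⟩
    have hx' := hx
    rw [momentFibre_eq_image] at hx'
    obtain ⟨z, hz, hzx⟩ := hx'
    have hz1 := norm_eq_one_of_mem_torus hz
    have hD := hasDerivAt_along hv hγ hsm (evalForm fun _ : Fin p => z)
    rw [hγ0] at hD
    have happ : HasDerivAt (fun t => γ t z) (v z) 0 :=
      ((ContinuousLinearMap.apply ℂ (V m) z).restrictScalars ℝ).hasFDerivAt.comp_hasDerivAt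
        (0 : ℝ) hv
    have hcoord : ∀ j, HasDerivAt (fun t => γ t z j) (v z j) 0 := fun j =>
      ((EuclideanSpace.proj (𝕜 := ℂ) j).restrictScalars ℝ).hasFDerivAt.comp_hasDerivAt
        (0 : ℝ) happ
    have hprod := HasDerivAt.fun_finsetProd (u := Finset.univ) fun i _ => hcoord (σ i)
    -- The derivative of the section along `v`, evaluated at `(z, …, z)`, in two ways.
    have hval := hD.unique hprod
    have hyz : inner ℂ z (v z) = 0 :=
      inner_velocity_eq_zero (fun t => (hγ t).1) hz1 (hγ0.trans hzx.symm) happ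
    have hy : ∑ j, conj (z j) * v z j = 0 := by
      rw [← hyz, PiLp.inner_apply]
      simp [mul_comm]
    simp only [smul_eq_mul, hγ0, ← hzx, proj_self hz1] at hval
    rw [sum_prod_erase_eq_zero hσ hσ' (fun j => by rw [hk, hz]) hy] at hval
    ext u
    rw [covariantDerivative, compress_apply, ← hzx]
    simp only [proj_apply]
    rw [ContinuousMultilinearMap.map_smul_univ]
    exact smul_eq_zero_of_right _ hval

end BohrSommerfeld

end

/-- With `n = m + 1 ≥ 1`, for every `ν` in the simplex and every level `p ≥ 1`, the moment fibre
over `ν` is a properly embedded orientable submanifold of `ℂP^{n-1}`, and it satisfies the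
Bohr–Sommerfeld condition at level `p` if and only if `ν ∈ Δ ∩ (1/p) ℤ^{n-1}`. -/
theorem proposition4p1 (m p : ℕ) (hp : 0 < p) (ν : Fin m → ℝ)
    (hν : ν ∈ BohrSommerfeld.simplex m) :
    BohrSommerfeld.IsProperSubmanifold (BohrSommerfeld.momentFibre ν) ∧
    (BohrSommerfeld.SatisfiesBohrSommerfeld p (BohrSommerfeld.momentFibre ν) ↔
      ν ∈ BohrSommerfeld.simplex m ∩ BohrSommerfeld.scaledLattice m p) := by
  open BohrSommerfeld in
  exact ⟨isProperSubmanifold_momentFibre hν,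
    fun h => ⟨hν, mem_scaledLattice_of_flat_section hp hν h⟩,
    fun h => satisfiesBohrSommerfeld_of_mem_scaledLattice hp hν h.2⟩
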